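/- Let $F$ be a field of arbitrary characteristic, let $n\ge 3$, and let $\phi$ be a nondegenerate quadratic form on an $F$-vector space $V$ of dimension $2n+1$ (nondegenerate: the radical of the polar form $b_\phi$ of $\phi$ has dimension at most $1$, and $\phi$ has no nonzero zero on that radical). For a nondegenerate quadratic form $\psi$ let $\mathfrak{i}_0(\psi)$ denote its Witt index, the number $m$ of hyperbolic planes in a Witt decomposition $\psi\simeq m\mathbb{H}\perp\psi_{an}$ with $\psi_{an}$ anisotropic. Define the generic splitting tower of $\phi$ by $F_0:=F$, $\phi_0:=\phi_{an}$, and $F_k:=F_{k-1}(\phi_{k-1})$, $\phi_k:=(\phi_{F_k})_{an}$ for $k\ge 1$, stopping at the first $F_h$ with $\dim\phi_h\le 1$; here $K(\psi)$ is the function field of the projective quadric of a form $\psi$ over $K$. The $k$-th absolute higher Witt index is $\mathfrak{j}_k(\phi):=\mathfrak{i}_0(\phi_{F_k})$ for $0\le k\le h$. Let $X_2$ be the projective variety of $2$-dimensional totally isotropic subspaces of $V$, with function field $F(X_2)$. If $h\ge 2$ and $\mathfrak{j}_2(\phi)=2$, then $\mathfrak{i}_0(\phi_{F(X_2)})=2$.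 -/

import Mathlib

open scoped TensorProduct

noncomputable section

universe u v

namespace QuadForm

section Field

variable {F : Type u} [Field F] {V : Type v} [AddCommGroup V] [Module F V]

/-- Nondegeneracy in arbitrary characteristic: the radical
`{v ∈ rad b | φ v = 0}` of `φ` is zero and the radical `rad b` of the polar form `b` of `φ` has
dimension at most one. (In characteristic different from two this says `rad b = 0`.) -/
def IsNondegenerate (φ : QuadraticForm F V) : Prop :=
  φ.radical = ⊥ ∧ Module.finrank F (LinearMap.ker φ.polarBilin) ≤ 1

/-- `φ ≃ m ℍ ⊥ φ|_U` with `φ|_U` anisotropic. Here `QuadraticForm.dualProd F (Fin m → F)` is the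
hyperbolic space `m ℍ`, that is, the form `∑ xᵢ yᵢ` in `2m` variables, in any characteristic. -/
def IsWittDecomposition (φ : QuadraticForm F V) (m : ℕ) (U : Submodule F V) : Prop :=
  (φ.restrict U).Anisotropic ∧
    QuadraticMap.Equivalent φ ((QuadraticForm.dualProd F (Fin m → F)).prod (φ.restrict U))

/-- The Witt index `𝔦₀(φ)`: the number of hyperbolic planes in a Witt decomposition of `φ`.
(For nondegenerate `φ` there is exactly one such number.) -/
def wittIndex (φ : QuadraticForm F V) : ℕ :=
  sSup {m : ℕ | ∃ U : Submodule F V, IsWittDecomposition φ m U}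

/-- The underlying space of the anisotropic part of `φ`, the second summand of some Witt
decomposition of `φ` (well defined up to isometry). -/
def anisotropicSpace (φ : QuadraticForm F V) : Submodule F V :=
  Classical.epsilon fun U => ∃ m, IsWittDecomposition φ m U

/-- The anisotropic part `φ_an`. -/
def anisotropicPart (φ : QuadraticForm F V) : QuadraticForm F (anisotropicSpace φ) :=
  φ.restrict (anisotropicSpace φ)

variable [FiniteDimensional F V]

/-- The base change `φ_K` of `φ` to a field extension `K / F`, in arbitrary characteristic: write
`φ x = B x x` for a bilinear form `B`, not necessarily symmetric, and extend `B` to `K`.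
See `extend_tmul`; by `QuadraticMap.baseChange_ext` that property determines `φ_K`. -/
def extend (φ : QuadraticForm F V) (K : Type*) [Field K] [Algebra F K] :
    QuadraticForm K (K ⊗[F] V) :=
  LinearMap.BilinMap.toQuadraticMap
    (LinearMap.BilinForm.baseChange K (φ.toBilin (Module.finBasis F V)))

theorem extend_tmul (φ : QuadraticForm F V) (K : Type*) [Field K] [Algebra F K] (a : K) (x : V) :
    extend φ K (a ⊗ₜ[F] x) = a * a * algebraMap F K (φ x) := by
  have h : φ.toBilin (Module.finBasis F V) x x = φ x := by
    conv_rhs => rw [← QuadraticMap.toQuadraticMap_toBilin φ (Module.finBasis F V)]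
    rfl
  simp [extend, h, Algebra.smul_def, mul_comm]

/-! ### The variety `X_d` of totally isotropic subspaces in its Plücker embedding -/

/-- Indices of the Plücker coordinates on `d`-dimensional subspaces of `V`:
sequences `j₁ < ⋯ < j_d` of indices of basis vectors. -/
abbrev PluckerIndex (F : Type u) [Field F] (V : Type v) [AddCommGroup V] [Module F V] (d : ℕ) :
    Type :=
  Fin d ↪o Fin (Module.finrank F V)

/-- The Plücker coordinates of the span of `w₁, …, w_d ∈ V_E`: the `d × d` minors of the matrix of
coordinates of the `wᵢ` in an `F`-basis of `V`. -/
def pluckerCoord (F : Type u) [Field F] {V : Type v} [AddCommGroup V] [Module F V]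
    [FiniteDimensional F V] {E : Type u} [Field E] [Algebra F E] {d : ℕ} (w : Fin d → E ⊗[F] V)
    (J : PluckerIndex F V d) : E :=
  Matrix.det (Matrix.of fun i k : Fin d =>
    ((Module.finBasis F V).baseChange E).repr (w i) (J k))

/-- The homogeneous ideal, over `F`, of the variety `X_d` of `d`-dimensional totally isotropic
subspaces of `V` in its Plücker embedding: all polynomials over `F` that vanish at the Plücker
coordinates of every `d`-dimensional totally isotropic subspace of `V_E`, for every field
extension `E / F`. For `d = 1` this is the ideal of the projective quadric of `φ`. -/
def isotropicIdeal (φ : QuadraticForm F V) (d : ℕ) :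
    Ideal (MvPolynomial (PluckerIndex F V d) F) where
  carrier := {f | ∀ (E : Type u) [Field E] [Algebra F E] (w : Fin d → E ⊗[F] V),
    LinearIndependent E w → (∀ x ∈ Submodule.span E (Set.range w), extend φ E x = 0) →
      MvPolynomial.aeval (pluckerCoord F w) f = 0}
  add_mem' hf hg E _ _ w hw hx := by rw [map_add, hf E w hw hx, hg E w hw hx, add_zero]
  zero_mem' E _ _ w _ _ := map_zero _
  smul_mem' c f hf E _ _ w hw hx := by rw [smul_eq_mul, map_mul, hf E w hw hx, mul_zero]

open Classical in
/-- The homogeneous prime ideal of `X_d` when `X_d` is irreducible. When it is not (so that it has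
no function field) the value is the conventional `⊥`. -/
def isotropicPrime (φ : QuadraticForm F V) (d : ℕ) :
    Ideal (MvPolynomial (PluckerIndex F V d) F) :=
  if (isotropicIdeal φ d).IsPrime then isotropicIdeal φ d else ⊥

instance isotropicPrime_isPrime (φ : QuadraticForm F V) (d : ℕ) : (isotropicPrime φ d).IsPrime := by
  unfold isotropicPrime
  split_ifs with h
  · exact h
  · exact Ideal.isPrime_bot

/-- The homogeneous coordinate ring of `X_d`. -/
abbrev CoordRing (φ : QuadraticForm F V) (d : ℕ) : Type u :=
  MvPolynomial (PluckerIndex F V d) F ⧸ isotropicPrime φ d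

/-- The function field `F(X_d)`: the quotients `f / g` of homogeneous elements of equal degree, in
the field of fractions of the homogeneous coordinate ring of `X_d`. (These quotients already form
a field, and a quotient by `0` is `0` here.) -/
def functionField (φ : QuadraticForm F V) (d : ℕ) :
    IntermediateField F (FractionRing (CoordRing φ d)) :=
  IntermediateField.adjoin F
    {z | ∃ (k : ℕ) (f g : MvPolynomial (PluckerIndex F V d) F), f.IsHomogeneous k ∧
      g.IsHomogeneous k ∧
      z = algebraMap (CoordRing φ d) _ (Ideal.Quotient.mk _ f) /
        algebraMap (CoordRing φ d) _ (Ideal.Quotient.mk _ g)}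

end Field

/-! ### The generic splitting tower -/

/-- A field extension of `F`. -/
structure FieldExt (F : Type u) [Field F] where
  carrier : Type u
  [field : Field carrier]
  [algebra : Algebra F carrier]

attribute [instance] FieldExt.field FieldExt.algebra

section Tower

variable {F : Type u} [Field F] {V : Type v} [AddCommGroup V] [Module F V] [FiniteDimensional F V]

/-- The extension `K(ψ) / F`, for an extension `K / F` and the function field `K(ψ)` of the
projective quadric `X_1` of a quadratic form `ψ` over `K`. -/
def FieldExt.step (K : FieldExt F) {U : Type v} [AddCommGroup U] [Module K.carrier U]
    [FiniteDimensional K.carrier U] (ψ : QuadraticForm K.carrier U) : FieldExt F :=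
  letI : Algebra F (functionField ψ 1) :=
    ((algebraMap K.carrier (functionField ψ 1)).comp (algebraMap F K.carrier)).toAlgebra
  { carrier := functionField ψ 1 }

open Classical in
/-- The generic splitting tower of `φ`: `F_0 = F` and `F_{k+1} = F_k(φ_k)`, where `φ_k` is the
anisotropic part of `φ_{F_k}`. It becomes constant at the first `F_h` with `dim φ_h ≤ 1`. -/
def tower (φ : QuadraticForm F V) : ℕ → FieldExt F
  | 0 => { carrier := F }
  | k + 1 =>
    let K := tower φ k
    if Module.finrank K.carrier (anisotropicSpace (extend φ K.carrier)) ≤ 1 then K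
    else K.step (anisotropicPart (extend φ K.carrier))

/-- The `k`-th absolute higher Witt index `𝔧_k(φ) = 𝔦₀(φ_{F_k})`. -/
def absoluteWittIndex (φ : QuadraticForm F V) (k : ℕ) : ℕ :=
  wittIndex (extend φ (tower φ k).carrier)

end Tower

end QuadForm

end

/-! The tower matters only through one extension `L` of `F` over which `φ` has Witt index 2; the
argument works for any such `L`. Over `F(X_2)` the index is at least 2 because of the tautological
plane, whose basis consists of ratios of Plücker coordinates
(`exists_isIsotropicFamily_functionField`).

For the upper bound, an isotropic `k`-family over `F(X_2)` specializes to one over `L` at every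
`L`-point of the cone over `X_2` where a certain nonzero function `c` survives
(`IsIsotropicFamily.exists_specialization`), and then `k ≤ 2`. Such a point exists because the
`L`-points are dense (`exists_algHom_coordRing`). To see this, fix an isotropic plane over `L` and
apply four reflections in generic vectors. Over an algebraically closed field, four reflections
carry any basis of an isotropic plane to any other (`exists_reflectionProduct_eq`), so the affine
space of reflection vectors dominates the cone. Hence the ideal of `X_2` is the kernel of a map into
a polynomial ring over `L` (`mem_isotropicIdeal_iff_genericPoint`). This gives primality and, as `L`
is infinite, density. A finite `L` is impossible: by Chevalley–Warning, Witt index 2 would force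
dimension at most 6.

Reflections are multiplied by `Q v`, so they are polynomial in `v`. In characteristic 2 the polar
form may be degenerate; what replaces its nondegeneracy is the vanishing of the radical of the
quadratic form. -/

open scoped TensorProduct

noncomputable section

universe u v

namespace QuadForm

open QuadraticMap

/-! ### Denominator-free reflections -/

section Reflection

variable {A W : Type*} [CommRing A] [AddCommGroup W] [Module A W]

/-- The reflection in `v`, multiplied by `Q v`, so that no denominators occur. -/
def scaledReflection (Q : QuadraticForm A W) (v : W) : W →ₗ[A] W :=
  Q v • LinearMap.id - (polarBilin Q v).smulRight v

theorem scaledReflection_apply (Q : QuadraticForm A W) (v x : W) :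
    scaledReflection Q v x = Q v • x - polar Q v x • v := by
  simp [scaledReflection]

theorem map_sub_eq (Q : QuadraticForm A W) (x y : W) : Q (x - y) = Q x + Q y - polar Q x y := by
  rw [sub_eq_add_neg, QuadraticMap.map_add Q, QuadraticMap.map_neg, polar_neg_right]
  ring

theorem map_scaledReflection (Q : QuadraticForm A W) (v x : W) :
    Q (scaledReflection Q v x) = Q v ^ 2 * Q x := by
  rw [scaledReflection_apply, map_sub_eq]
  simp only [QuadraticMap.map_smul, polar_smul_left, polar_smul_right, smul_eq_mul,
    polar_comm Q x v]
  ring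

theorem scaledReflection_scaledReflection (Q : QuadraticForm A W) (v x : W) :
    scaledReflection Q v (scaledReflection Q v x) = Q v ^ 2 • x := by
  simp only [scaledReflection_apply, polar_sub_right, polar_smul_right, polar_self, smul_sub,
    smul_smul, sub_smul, smul_eq_mul]
  module

/-- For isotropic `x` and `y`, `Q (x - y) = -polar Q x y`, so two non-orthogonal isotropic vectors
are exchanged up to a nonzero scalar. -/
theorem scaledReflection_sub {Q : QuadraticForm A W} {x y : W} (hx : Q x = 0) (hy : Q y = 0) :
    scaledReflection Q (x - y) x = Q (x - y) • y := by
  rw [scaledReflection_apply, map_sub_eq, polar_sub_left, polar_self, hx, hy, polar_comm Q y x]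
  module

theorem scaledReflection_of_polar_eq_zero {Q : QuadraticForm A W} {v x : W}
    (h : polar Q v x = 0) : scaledReflection Q v x = Q v • x := by
  rw [scaledReflection_apply, h, zero_smul, sub_zero]

theorem scaledReflection_smul (Q : QuadraticForm A W) (c : A) (v x : W) :
    scaledReflection Q (c • v) x = c ^ 2 • scaledReflection Q v x := by
  simp only [scaledReflection_apply, QuadraticMap.map_smul, polar_smul_left, smul_eq_mul]
  module

end Reflection

/-! ### Isotropic families and transitivity of reflections -/

section Isotropic

variable {K W : Type*} [Field K] [AddCommGroup W] [Module K W]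

/-- A basis of a totally isotropic subspace. -/
structure IsIsotropicFamily {ι : Type*} (Q : QuadraticForm K W) (w : ι → W) : Prop where
  linearIndependent : LinearIndependent K w
  map_eq_zero : ∀ i, Q (w i) = 0
  polar_eq_zero : ∀ i j, polar Q (w i) (w j) = 0

theorem IsIsotropicFamily.of_forall_mem_span {ι : Type*} {Q : QuadraticForm K W} {w : ι → W}
    (hw : LinearIndependent K w) (h : ∀ x ∈ Submodule.span K (Set.range w), Q x = 0) :
    IsIsotropicFamily Q w := by
  have hm : ∀ i, w i ∈ Submodule.span K (Set.range w) := fun i =>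
    Submodule.subset_span (Set.mem_range_self i)
  refine ⟨hw, fun i => h _ (hm i), fun i j => ?_⟩
  rw [polar, h _ (hm i), h _ (hm j), h _ (add_mem (hm i) (hm j))]
  simp

theorem IsIsotropicFamily.polar_eq_zero_of_mem {ι : Type*} {Q : QuadraticForm K W} {w : ι → W}
    (h : IsIsotropicFamily Q w) {x y : W} (hx : x ∈ Submodule.span K (Set.range w))
    (hy : y ∈ Submodule.span K (Set.range w)) : polar Q x y = 0 := by
  induction hx, hy using Submodule.span_induction₂ with
  | mem_mem x y hx hy =>
    obtain ⟨i, rfl⟩ := hx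
    obtain ⟨j, rfl⟩ := hy
    exact h.polar_eq_zero i j
  | zero_left y hy => simp
  | zero_right x hx => simp
  | add_left x y z _ _ _ h1 h2 => rw [polar_add_left, h1, h2, add_zero]
  | add_right x y z _ _ _ h1 h2 => rw [polar_add_right, h1, h2, add_zero]
  | smul_left r x y _ _ h1 => rw [polar_smul_left, h1, smul_zero]
  | smul_right r x y _ _ h1 => rw [polar_smul_right, h1, smul_zero]

theorem IsIsotropicFamily.map_eq_zero_of_mem {ι : Type*} {Q : QuadraticForm K W} {w : ι → W}
    (h : IsIsotropicFamily Q w) {x : W} (hx : x ∈ Submodule.span K (Set.range w)) :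
    Q x = 0 := by
  induction hx using Submodule.span_induction with
  | mem x hx => obtain ⟨i, rfl⟩ := hx; exact h.map_eq_zero i
  | zero => simp
  | add x y hx hy h1 h2 =>
    rw [QuadraticMap.map_add Q, h1, h2, h.polar_eq_zero_of_mem hx hy]; simp
  | smul r x _ h1 => rw [QuadraticMap.map_smul, h1, smul_zero]

/-- A map that multiplies the form by a nonzero constant preserves isotropic families. -/
theorem IsIsotropicFamily.map {W' ι : Type*} [AddCommGroup W'] [Module K W']
    {Q : QuadraticForm K W} {Q' : QuadraticForm K W'}
    {w : ι → W} (h : IsIsotropicFamily Q w) (f : W →ₗ[K] W') (hf : Function.Injective f)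
    (c : K) (hQ : ∀ x, Q' (f x) = c * Q x) : IsIsotropicFamily Q' fun i => f (w i) := by
  refine ⟨h.linearIndependent.map' f (LinearMap.ker_eq_bot.2 hf), fun i => ?_, fun i j => ?_⟩
  · rw [hQ, h.map_eq_zero, mul_zero]
  · have := h.polar_eq_zero i j
    simp only [polar, ← map_add, hQ, ← mul_sub] at this ⊢
    rw [this, mul_zero]

theorem scaledReflection_injective {Q : QuadraticForm K W} {v : W} (hv : Q v ≠ 0) :
    Function.Injective (scaledReflection Q v) := by
  intro x y hxy
  have := congrArg (scaledReflection Q v) hxy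
  rw [scaledReflection_scaledReflection, scaledReflection_scaledReflection] at this
  exact (smul_right_injective W (pow_ne_zero 2 hv)) this

theorem IsIsotropicFamily.scaledReflection {ι : Type*} {Q : QuadraticForm K W} {w : ι → W}
    (h : IsIsotropicFamily Q w) {v : W} (hv : Q v ≠ 0) :
    IsIsotropicFamily Q fun i => scaledReflection Q v (w i) :=
  h.map _ (scaledReflection_injective hv) _ (map_scaledReflection Q v)

theorem eq_zero_of_radical_eq_bot {Q : QuadraticForm K W} (hQ : Q.radical = ⊥) {x : W}
    (hx : Q x = 0) (h : ∀ y, polar Q x y = 0) : x = 0 := by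
  have : x ∈ Q.radical := mem_radical_iff'.2 ⟨hx, fun n => by
    rw [QuadraticMap.map_add Q, hx, h]; simp⟩
  rwa [hQ, Submodule.mem_bot] at this

/-- The composition of four scaled reflections. -/
def reflectionProduct {A W : Type*} [CommRing A] [AddCommGroup W] [Module A W]
    (Q : QuadraticForm A W) (x : Fin 4 → W) : W →ₗ[A] W :=
  scaledReflection Q (x 3) ∘ₗ scaledReflection Q (x 2) ∘ₗ
    scaledReflection Q (x 1) ∘ₗ scaledReflection Q (x 0)

theorem IsIsotropicFamily.reflectionProduct {ι : Type*} {Q : QuadraticForm K W} {w : ι → W}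
    (h : IsIsotropicFamily Q w) {x : Fin 4 → W} (hx : ∀ k, Q (x k) ≠ 0) :
    IsIsotropicFamily Q fun i => reflectionProduct Q x (w i) :=
  (((h.scaledReflection (hx 0)).scaledReflection (hx 1)).scaledReflection (hx 2)).scaledReflection
    (hx 3)

/-- Otherwise the functional of `a` vanishes on the kernel of that of `c`, hence is a multiple `l`
of it; then `a - l • c` is isotropic and orthogonal to everything, so zero. A suitable `z`, once
normalized, becomes isotropic after subtracting `Q z • a`. -/
theorem exists_orthogonal_polar_ne_zero {Q : QuadraticForm K W} (hQ : Q.radical = ⊥) {a c : W}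
    (ha : Q a = 0) (hc : Q c = 0) (hac : polar Q a c = 0)
    (hn : a ∉ Submodule.span K {c}) : ∃ z, Q z = 0 ∧ polar Q c z = 0 ∧ polar Q a z = 1 := by
  obtain ⟨z, hz1, hz2⟩ : ∃ z, polar Q c z = 0 ∧ polar Q a z ≠ 0 := by
    by_contra! hcon
    have hmem := mem_span_of_iInf_ker_le_ker (ι := Unit) (L := fun _ => polarBilin Q c)
      (K := polarBilin Q a) (fun z hz => by
        simp only [Submodule.mem_iInf, LinearMap.mem_ker, polarBilin_apply_apply] at hz ⊢
        exact hcon z (hz ()))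
    rw [Set.range_const, Submodule.mem_span_singleton] at hmem
    obtain ⟨l, hl⟩ := hmem
    apply hn
    rw [Submodule.mem_span_singleton]
    refine ⟨l, (sub_eq_zero.1 (eq_zero_of_radical_eq_bot hQ ?_ fun y => ?_)).symm⟩
    · rw [map_sub_eq, QuadraticMap.map_smul, polar_smul_right, ha, hc, hac]; simp
    · have := LinearMap.congr_fun hl y
      simp only [LinearMap.smul_apply, polarBilin_apply_apply] at this
      rw [polar_sub_left, polar_smul_left, this, sub_self]
  have hz3 : polar Q a ((polar Q a z)⁻¹ • z) = 1 := by
    rw [polar_smul_right, smul_eq_mul, inv_mul_cancel₀ hz2]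
  refine ⟨(polar Q a z)⁻¹ • z - Q ((polar Q a z)⁻¹ • z) • a, ?_, ?_, ?_⟩
  · rw [map_sub_eq, QuadraticMap.map_smul Q (Q _), ha, polar_smul_right, polar_comm Q _ a, hz3]
    simp
  · rw [polar_sub_right, polar_smul_right, polar_smul_right, hz1, polar_comm Q c, hac]; simp
  · rw [polar_sub_right, hz3, polar_smul_right, polar_self, ha]; simp

variable [FiniteDimensional K W]

/-- The polar form maps `T` into its own annihilator, injectively because isotropic vectors in the
polar radical vanish. -/
theorem two_mul_finrank_le_of_totallyIsotropic {Q : QuadraticForm K W} (hQ : Q.radical = ⊥)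
    (T : Submodule K W) (hT : ∀ x ∈ T, Q x = 0) :
    2 * Module.finrank K T ≤ Module.finrank K W := by
  have hpol : ∀ x ∈ T, ∀ y ∈ T, polar Q x y = 0 := fun x hx y hy => by
    rw [polar, hT _ hx, hT _ hy, hT _ (add_mem hx hy)]; simp
  let f : T →ₗ[K] T.dualAnnihilator := ((polarBilin Q).domRestrict T).codRestrict _ fun x =>
    (Submodule.mem_dualAnnihilator _).2 fun y hy => hpol x x.2 y hy
  have hf : Function.Injective f := by
    refine (injective_iff_map_eq_zero f).2 fun x hx => ?_
    have hx' : polarBilin Q x = 0 := congrArg Subtype.val hx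
    exact Subtype.ext (eq_zero_of_radical_eq_bot hQ (hT x x.2) fun y => by
      simpa using LinearMap.congr_fun hx' y)
  have h1 := LinearMap.finrank_le_finrank_of_injective hf
  have h2 := Subspace.finrank_add_finrank_dualAnnihilator_eq T
  omega

/-- Three linear conditions leave dimension at least `d - 3`, which exceeds `d / 2` once `d ≥ 7`; so
this subspace is not totally isotropic. -/
theorem exists_orthogonal_anisotropic {Q : QuadraticForm K W} (hQ : Q.radical = ⊥)
    (hd : 7 ≤ Module.finrank K W) (a b c : W) :
    ∃ u, polar Q a u = 0 ∧ polar Q b u = 0 ∧ polar Q c u = 0 ∧ Q u ≠ 0 := by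
  by_contra! hcon
  let f : W →ₗ[K] K × K × K :=
    (polarBilin Q a).prod ((polarBilin Q b).prod (polarBilin Q c))
  have h1 := two_mul_finrank_le_of_totallyIsotropic hQ (LinearMap.ker f) (fun x hx => by
    exact hcon x (congrArg Prod.fst hx) (congrArg (fun p => p.2.1) hx)
      (congrArg (fun p => p.2.2) hx))
  have h2 := LinearMap.finrank_range_add_finrank_ker f
  have h3 := Submodule.finrank_le (LinearMap.range f)
  simp only [Module.finrank_prod, Module.finrank_self] at h3
  omega

/-- Provides the intermediate vector for moving `a` to `z` and `z` to `b` by reflections that fix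
`c` up to a scalar. -/
theorem exists_isotropic_polar_ne_zero {Q : QuadraticForm K W} (hQ : Q.radical = ⊥)
    (hd : 7 ≤ Module.finrank K W) {a b c : W} (ha : Q a = 0) (hb : Q b = 0) (hc : Q c = 0)
    (hac : polar Q a c = 0) (hbc : polar Q b c = 0) (han : a ∉ Submodule.span K {c})
    (hbn : b ∉ Submodule.span K {c}) :
    ∃ z, Q z = 0 ∧ polar Q c z = 0 ∧ polar Q a z ≠ 0 ∧ polar Q b z ≠ 0 := by
  by_cases hab : polar Q a b = 0
  · obtain ⟨x, hx1, hx2, hx3⟩ := exists_orthogonal_polar_ne_zero hQ ha hc hac han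
    obtain ⟨y, hy1, hy2, hy3⟩ := exists_orthogonal_polar_ne_zero hQ hb hc hbc hbn
    by_cases hbx : polar Q b x = 0
    · by_cases hay : polar Q a y = 0
      -- `x + y` pairs to 1 with both `a` and `b`, and `Q (x + y) = polar Q x y` is cancelled by the
      -- multiple of `a`.
      · refine ⟨x + y - polar Q x y • a, ?_, ?_, ?_, ?_⟩
        · rw [map_sub_eq, QuadraticMap.map_add Q, QuadraticMap.map_smul, polar_smul_right,
            polar_comm Q (x + y), polar_add_right, hx1, hy1, ha, hx3, hay]
          simp
        · rw [polar_sub_right, polar_add_right, polar_smul_right, polar_comm Q c a]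
          simp [hx2, hy2, hac]
        · rw [polar_sub_right, polar_add_right, polar_smul_right, polar_self]
          simp [hx3, hay, ha]
        · rw [polar_sub_right, polar_add_right, polar_smul_right, polar_comm Q b a]
          simp [hy3, hbx, hab]
      · exact ⟨y, hy1, hy2, hay, by simp [hy3]⟩
    · exact ⟨x, hx1, hx2, by simp [hx3], hbx⟩
  · obtain ⟨u, hu1, hu2, hu3, hu4⟩ := exists_orthogonal_anisotropic hQ hd a b c
    -- The coefficient of `b` is forced by isotropy; the pairings with `a` and `b` are `-Q u` and
    -- `polar Q a b`.
    refine ⟨a + u - (Q u / polar Q a b) • b, ?_, ?_, ?_, ?_⟩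
    · rw [map_sub_eq, QuadraticMap.map_add Q, QuadraticMap.map_smul, polar_smul_right,
        polar_add_left, polar_comm Q u b, ha, hb, hu1, hu2]
      simp [div_mul_cancel₀ _ hab]
    · rw [polar_sub_right, polar_add_right, polar_smul_right, polar_comm Q c a, polar_comm Q c b]
      simp [hac, hbc, hu3]
    · rw [polar_sub_right, polar_add_right, polar_smul_right, polar_self]
      simp [ha, hu1, hu4, div_mul_cancel₀ _ hab]
    · rw [polar_sub_right, polar_add_right, polar_smul_right, polar_self, polar_comm Q b a]
      simp [hb, hu2, hab]

theorem exists_scaledReflection_eq {Q : QuadraticForm K W} (hQ : Q.radical = ⊥)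
    (hd : 7 ≤ Module.finrank K W) {a b c : W} (ha : Q a = 0) (hb : Q b = 0) (hc : Q c = 0)
    (hac : polar Q a c = 0) (hbc : polar Q b c = 0) (han : a ∉ Submodule.span K {c})
    (hbn : b ∉ Submodule.span K {c}) :
    ∃ x y, Q x ≠ 0 ∧ Q y ≠ 0 ∧ polar Q x c = 0 ∧ polar Q y c = 0 ∧
      scaledReflection Q y (scaledReflection Q x a) = (Q x * Q y) • b := by
  obtain ⟨z, hz, hcz, haz, hbz⟩ := exists_isotropic_polar_ne_zero hQ hd ha hb hc hac hbc han hbn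
  refine ⟨a - z, z - b, ?_, ?_, ?_, ?_, ?_⟩
  · simpa [map_sub_eq, ha, hz] using haz
  · simpa [map_sub_eq, hb, hz, polar_comm Q z b] using hbz
  · rw [polar_sub_left, hac, polar_comm Q z, hcz, sub_zero]
  · rw [polar_sub_left, hbc, polar_comm Q z, hcz, sub_zero]
  · rw [scaledReflection_sub ha hz, map_smul, scaledReflection_sub hz hb, smul_smul]

/-- Over an algebraically closed field, products of four scaled reflections act transitively on
bases of totally isotropic planes. -/
theorem exists_reflectionProduct_eq [IsAlgClosed K] {Q : QuadraticForm K W} (hQ : Q.radical = ⊥)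
    (hd : 7 ≤ Module.finrank K W) {e w : Fin 2 → W} (he : IsIsotropicFamily Q e)
    (hw : IsIsotropicFamily Q w) : ∃ x : Fin 4 → W, ∀ i, reflectionProduct Q x (e i) = w i := by
  -- With `c = 0` there is no orthogonality constraint: this moves `e 0` to the line of `w 0`.
  obtain ⟨x, y, hx, hy, -, -, hxy⟩ := exists_scaledReflection_eq hQ hd (c := 0)
    (he.map_eq_zero 0) (hw.map_eq_zero 0) (by simp) (by simp) (by simp)
    (by simpa using he.linearIndependent.ne_zero 0) (by simpa using hw.linearIndependent.ne_zero 0)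
  have he' : IsIsotropicFamily Q fun i => (Q x * Q y)⁻¹ •
      scaledReflection Q y (scaledReflection Q x (e i)) :=
    ((he.scaledReflection hx).scaledReflection hy).map (LinearMap.lsmul K W (Q x * Q y)⁻¹)
      (smul_right_injective W (inv_ne_zero (mul_ne_zero hx hy))) ((Q x * Q y)⁻¹ ^ 2) fun z => by
        rw [LinearMap.lsmul_apply, QuadraticMap.map_smul, smul_eq_mul, pow_two]
  have h0 : (Q x * Q y)⁻¹ • scaledReflection Q y (scaledReflection Q x (e 0)) = w 0 := by
    rw [hxy, inv_smul_smul₀ (mul_ne_zero hx hy)]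
  have hspan : ∀ {g : Fin 2 → W}, LinearIndependent K g → g 1 ∉ Submodule.span K {g 0} := by
    intro g hg hmem
    have := hg.notMem_span_image (s := {0}) (x := 1) (by simp)
    simp only [Set.image_singleton] at this
    exact this hmem
  -- The second pair of reflections preserves the line of `w 0` while moving the image of `e 1` to
  -- that of `w 1`.
  obtain ⟨s, t, hs, ht, hs0, ht0, hst⟩ := exists_scaledReflection_eq hQ hd (c := w 0)
    (he'.map_eq_zero 1) (hw.map_eq_zero 1) (hw.map_eq_zero 0)
    (by have := he'.polar_eq_zero 1 0; rwa [h0] at this)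
    (hw.polar_eq_zero 1 0)
    (by have := hspan he'.linearIndependent; rwa [h0] at this)
    (hspan hw.linearIndependent)
  have hxy0 := mul_ne_zero hx hy
  have hst0 := mul_ne_zero hs ht
  -- Both basis vectors acquire the same scalar. Replacing `t` by `r • t` multiplies the product by
  -- `r ^ 2`, which removes it.
  obtain ⟨r, hr⟩ := IsAlgClosed.exists_pow_nat_eq ((Q x * Q y) * (Q s * Q t))⁻¹ (n := 2) (by simp)
  refine ⟨![x, y, s, r • t], fun i => ?_⟩
  have key : scaledReflection Q t (scaledReflection Q s
      ((Q x * Q y)⁻¹ • scaledReflection Q y (scaledReflection Q x (e i)))) =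
        (Q s * Q t) • w i := by
    fin_cases i
    · dsimp only [Fin.zero_eta]
      rw [h0, scaledReflection_of_polar_eq_zero hs0, map_smul,
        scaledReflection_of_polar_eq_zero ht0, smul_smul]
    · exact hst
  rw [map_smul, map_smul, inv_smul_eq_iff₀ hxy0] at key
  simp only [QuadForm.reflectionProduct, LinearMap.comp_apply]
  simp only [Fin.isValue, Matrix.cons_val, scaledReflection_smul]
  rw [key, hr, smul_smul (Q x * Q y), inv_smul_smul₀ (mul_ne_zero hxy0 hst0)]

end Isotropic

/-! ### Witt decompositions and isotropic families -/

section Witt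

variable {K W : Type*} [Field K] [AddCommGroup W] [Module K W]

theorem IsIsotropicFamily.isometryEquiv {W' ι : Type*} [AddCommGroup W'] [Module K W']
    {Q : QuadraticForm K W} {Q' : QuadraticForm K W'} {w : ι → W} (h : IsIsotropicFamily Q w)
    (f : Q.IsometryEquiv Q') : IsIsotropicFamily Q' fun i => f (w i) :=
  h.map f.toLinearEquiv.toLinearMap f.toLinearEquiv.injective 1 fun x => by
    rw [one_mul]; exact f.map_app x

/-- Project `T` to `D`. The kernel embeds in `N` by `h1`, and by `h2` the image lies in the
annihilator of the kernel, so the two dimensions add up to at most that of `N`. -/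
theorem finrank_le_of_pairing {D N U : Type*} [AddCommGroup D] [Module K D] [AddCommGroup N]
    [Module K N] [AddCommGroup U] [Module K U] [FiniteDimensional K D] [FiniteDimensional K N]
    [FiniteDimensional K U] (β : D →ₗ[K] Module.Dual K N) (hβ : Function.Injective β)
    (T : Submodule K ((D × N) × U)) (h1 : ∀ x ∈ T, x.1.1 = 0 → x.2 = 0)
    (h2 : ∀ x ∈ T, ∀ y ∈ T, x.1.1 = 0 → β y.1.1 x.1.2 = 0) :
    Module.finrank K T ≤ Module.finrank K N := by
  let p : T →ₗ[K] D := LinearMap.fst K _ _ ∘ₗ LinearMap.fst K _ _ ∘ₗ T.subtype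
  let s : LinearMap.ker p →ₗ[K] N :=
    LinearMap.snd K _ _ ∘ₗ LinearMap.fst K _ _ ∘ₗ T.subtype ∘ₗ (LinearMap.ker p).subtype
  have hs : Function.Injective s := by
    rintro ⟨⟨⟨⟨g, y⟩, u⟩, hT⟩, (rfl : g = 0)⟩ ⟨⟨⟨⟨g', y'⟩, u'⟩, hT'⟩, (rfl : g' = 0)⟩ (rfl : y = y')
    obtain rfl : u = 0 := h1 _ hT rfl
    obtain rfl : u' = 0 := h1 _ hT' rfl
    rfl
  have hrange : LinearMap.range (β ∘ₗ p) ≤ (LinearMap.range s).dualAnnihilator := by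
    rintro _ ⟨y, rfl⟩
    rw [Submodule.mem_dualAnnihilator]
    rintro _ ⟨x, rfl⟩
    exact h2 _ x.1.2 _ y.2 x.2
  have h3 := LinearMap.finrank_range_add_finrank_ker p
  have h4 := Submodule.finrank_mono hrange
  have h5 := Subspace.finrank_add_finrank_dualAnnihilator_eq (LinearMap.range s)
  have h6 := LinearMap.finrank_range_of_inj hs
  rw [LinearMap.range_comp, ← (Submodule.equivMapOfInjective β hβ _).finrank_eq] at h4
  omega

/-- A totally isotropic family in `m ℍ ⊥ P`, with `P` anisotropic, has at most `m` members. -/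
theorem IsIsotropicFamily.card_le_of_anisotropic {U : Type*} [AddCommGroup U] [Module K U]
    [FiniteDimensional K U] {P : QuadraticForm K U} (hP : P.Anisotropic) {m k : ℕ}
    {t : Fin k → (Module.Dual K (Fin m → K) × (Fin m → K)) × U}
    (ht : IsIsotropicFamily ((QuadraticForm.dualProd K (Fin m → K)).prod P) t) : k ≤ m := by
  have h := finrank_le_of_pairing (LinearMap.id : Module.Dual K (Fin m → K) →ₗ[K] _)
    Function.injective_id (Submodule.span K (Set.range t))
    (by
      rintro ⟨⟨g, x⟩, u⟩ hT (rfl : g = 0)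
      exact hP _ (by simpa using ht.map_eq_zero_of_mem hT))
    (by
      rintro ⟨⟨g, x⟩, u⟩ hT ⟨⟨g', x'⟩, u'⟩ hT' (rfl : g = 0)
      obtain rfl : u = 0 := hP _ (by simpa using ht.map_eq_zero_of_mem hT)
      simpa [polar] using ht.polar_eq_zero_of_mem hT' hT)
  rwa [finrank_span_eq_card ht.linearIndependent, Fintype.card_fin, Module.finrank_fin_fun] at h

theorem IsWittDecomposition.exists_isIsotropicFamily {Q : QuadraticForm K W} {m : ℕ}
    {U : Submodule K W} (h : IsWittDecomposition Q m U) :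
    ∃ e : Fin m → W, IsIsotropicFamily Q e := by
  obtain ⟨f⟩ := h.2
  let g : (Fin m → K) →ₗ[K] (Module.Dual K (Fin m → K) × (Fin m → K)) × U :=
    LinearMap.inl K _ _ ∘ₗ LinearMap.inr K _ _
  have hg : Function.Injective g := LinearMap.inl_injective.comp LinearMap.inr_injective
  have h0 : IsIsotropicFamily (0 : QuadraticForm K (Fin m → K)) (Pi.basisFun K (Fin m)) :=
    ⟨(Pi.basisFun K (Fin m)).linearIndependent, by simp, by simp [polar]⟩
  exact ⟨_, (h0.map g hg 1 (Q' := (QuadraticForm.dualProd K (Fin m → K)).prod (Q.restrict U))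
    (fun x => by simp [g])).isometryEquiv f.symm⟩

/-- A totally isotropic plane is contained in a hyperbolic space. -/
theorem IsIsotropicFamily.exists_dual {Q : QuadraticForm K W} (hQ : Q.radical = ⊥)
    {e : Fin 2 → W} (he : IsIsotropicFamily Q e) :
    ∃ f : Fin 2 → W, (∀ i, Q (f i) = 0) ∧ polar Q (f 0) (f 1) = 0 ∧
      ∀ i j, polar Q (e i) (f j) = if i = j then 1 else 0 := by
  have hspan : ∀ i j : Fin 2, i ≠ j → e i ∉ Submodule.span K {e j} := fun i j hij => by
    have := he.linearIndependent.notMem_span_image (s := {j}) (x := i) (by simpa using hij)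
    simpa only [Set.image_singleton] using this
  obtain ⟨x, hx, hx1, hx0⟩ := exists_orthogonal_polar_ne_zero hQ (he.map_eq_zero 0)
    (he.map_eq_zero 1) (he.polar_eq_zero 0 1) (hspan 0 1 (by simp))
  obtain ⟨y, hy, hy0, hy1⟩ := exists_orthogonal_polar_ne_zero hQ (he.map_eq_zero 1)
    (he.map_eq_zero 0) (he.polar_eq_zero 1 0) (hspan 1 0 (by simp))
  refine ⟨![x, y - polar Q x y • e 0], fun i => ?_, ?_, fun i j => ?_⟩
  · fin_cases i
    · exact hx
    · simp [map_sub_eq, QuadraticMap.map_smul, hy, he.map_eq_zero, polar_comm Q y, hy0]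
  · simp [polar_sub_right, polar_smul_right, polar_comm Q x (e 0), hx0]
  · fin_cases i <;> fin_cases j <;>
      simp [hx0, hx1, hy0, hy1, polar_sub_right, polar_smul_right, he.polar_eq_zero]

/-- The plane and its dual span a hyperbolic space, which splits off. An isotropic vector in the
orthogonal complement `U` would enlarge `e` to an isotropic triple. -/
theorem IsIsotropicFamily.exists_isWittDecomposition {Q : QuadraticForm K W}
    (hQ : Q.radical = ⊥) {e : Fin 2 → W} (he : IsIsotropicFamily Q e)
    (hmax : ∀ t : Fin 3 → W, ¬ IsIsotropicFamily Q t) :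
    ∃ U : Submodule K W, IsWittDecomposition Q 2 U := by
  obtain ⟨f, hf, hff, hef⟩ := he.exists_dual hQ
  have hfe : ∀ i j, polar Q (f j) (e i) = if i = j then 1 else 0 := fun i j => by
    rw [polar_comm, hef]
  have hfp : ∀ i j, polar Q (f i) (f j) = 0 := by
    intro i j
    fin_cases i <;> fin_cases j <;> simp [hf, hff, polar_comm Q (f 1) (f 0)]
  let U : Submodule K W :=
    ⨅ i, (LinearMap.ker (polarBilin Q (e i)) ⊓ LinearMap.ker (polarBilin Q (f i)))
  have hU : ∀ {u}, u ∈ U ↔ ∀ i, polar Q (e i) u = 0 ∧ polar Q (f i) u = 0 := by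
    intro u; simp [U, Submodule.mem_iInf]
  refine ⟨U, ?_, ?_⟩
  · rintro ⟨u, hu⟩ hu0
    replace hu0 : Q u = 0 := hu0
    have hu' := hU.1 hu
    by_contra hne
    have hne' : u ≠ 0 := fun h => hne (Subtype.ext h)
    refine hmax (Fin.snoc e u) ⟨?_, ?_, ?_⟩
    · rw [linearIndependent_finSnoc]
      refine ⟨he.linearIndependent, fun hmem => hne' ?_⟩
      rw [Submodule.mem_span_range_iff_exists_fun] at hmem
      obtain ⟨c, rfl⟩ := hmem
      have h0 := (hu' 0).2
      have h1 := (hu' 1).2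
      simp [Fin.sum_univ_two, polar_add_right, polar_smul_right, hfe] at h0 h1
      simp [Fin.sum_univ_two, h0, h1]
    · intro i
      refine Fin.lastCases ?_ (fun i => ?_) i
      · simpa only [Fin.snoc_last] using hu0
      · simpa using he.map_eq_zero i
    · intro i j
      refine Fin.lastCases ?_ (fun i => ?_) i <;> refine Fin.lastCases ?_ (fun j => ?_) j
      · simp only [Fin.snoc_last, polar_self, hu0, smul_zero]
      · simpa only [Fin.snoc_last, Fin.snoc_castSucc, polar_comm Q u] using (hu' j).1
      · simpa only [Fin.snoc_last, Fin.snoc_castSucc] using (hu' i).1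
      · simpa using he.polar_eq_zero i j
  · let S : ((Module.Dual K (Fin 2 → K) × (Fin 2 → K)) × U) →ₗ[K] W :=
      LinearMap.coprod (LinearMap.coprod
        (∑ i, (Module.Dual.eval K (Fin 2 → K) (Pi.single i 1)).smulRight (f i))
        (∑ i, (LinearMap.proj i).smulRight (e i))) U.subtype
    have hS : ∀ g x u, S ((g, x), u) = g (Pi.single 0 1) • f 0 + g (Pi.single 1 1) • f 1 +
        (x 0 • e 0 + x 1 • e 1) + u := fun g x u => by
      simp [S, Fin.sum_univ_two]
    have hg : ∀ (g : Module.Dual K (Fin 2 → K)) (x : Fin 2 → K),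
        g x = x 0 * g (Pi.single 0 1) + x 1 * g (Pi.single 1 1) := fun g x => by
      conv_lhs => rw [← (Pi.basisFun K (Fin 2)).sum_repr x]
      simp [Fin.sum_univ_two]
    have hiso : ∀ z, Q (S z) =
        (QuadraticForm.dualProd K (Fin 2 → K)).prod (Q.restrict U) z := by
      rintro ⟨⟨g, x⟩, u, hu⟩
      have hu' := hU.1 hu
      rw [hS]
      simp only [QuadraticMap.map_add Q, QuadraticMap.map_smul, polar_add_left, polar_add_right,
        polar_smul_left, polar_smul_right, hf, hfp, hfe, he.map_eq_zero, he.polar_eq_zero,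
        (hu' _).1, (hu' _).2, QuadraticMap.prod_apply, QuadraticForm.dualProd_apply, hg g x,
        QuadraticMap.restrict_apply]
      simp
    have hinj : Function.Injective S := by
      refine (injective_iff_map_eq_zero S).2 ?_
      rintro ⟨⟨g, x⟩, u, hu⟩ h0
      have hu' := hU.1 hu
      rw [hS] at h0
      have he0 : ∀ i, polar Q (e i) 0 = 0 := fun i => by simp
      have hf0 : ∀ i, polar Q (f i) 0 = 0 := fun i => by simp
      simp only [← h0, polar_add_right, polar_smul_right, hef, hfe, hfp, he.polar_eq_zero,
        (hu' _).1, (hu' _).2] at he0 hf0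
      have a0 := he0 0
      have a1 := he0 1
      have b0 := hf0 0
      have b1 := hf0 1
      simp at a0 a1 b0 b1
      have hx : x = 0 := by ext i; fin_cases i <;> simp [b0, b1]
      have hg0 : g = 0 := LinearMap.ext fun y => by rw [hg, a0, a1]; simp
      have hu0 : u = 0 := by simpa [a0, a1, b0, b1] using h0
      subst hx hg0 hu0
      rfl
    -- Subtracting the projection of `z` to the hyperbolic space leaves a vector of `U`.
    have hsurj : Function.Surjective S := by
      intro z
      let u := z - (polar Q (e 0) z • f 0 + polar Q (e 1) z • f 1 +
        (polar Q (f 0) z • e 0 + polar Q (f 1) z • e 1))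
      have hu : u ∈ U := hU.2 fun i => by
        fin_cases i <;>
        simp [u, polar_sub_right, polar_add_right, polar_smul_right, hef, hfe, hfp,
          he.polar_eq_zero]
      refine ⟨((polar Q (e 0) z • LinearMap.proj 0 + polar Q (e 1) z • LinearMap.proj 1,
        ![polar Q (f 0) z, polar Q (f 1) z]), ⟨u, hu⟩), ?_⟩
      rw [hS]
      simp [u]
    let E := LinearEquiv.ofBijective S ⟨hinj, hsurj⟩
    exact QuadraticMap.Equivalent.symm ⟨⟨E, hiso⟩⟩

/-- The Witt index is two if totally isotropic subspaces of dimension two but none of larger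
dimension exist. -/
theorem wittIndex_eq_two {Q : QuadraticForm K W} (hQ : Q.radical = ⊥)
    (he : ∃ e : Fin 2 → W, IsIsotropicFamily Q e)
    (hmax : ∀ (k : ℕ) (t : Fin k → W), IsIsotropicFamily Q t → k ≤ 2) : wittIndex Q = 2 := by
  obtain ⟨e, he⟩ := he
  refine IsGreatest.csSup_eq ⟨?_, ?_⟩
  · exact he.exists_isWittDecomposition hQ fun t ht => absurd (hmax 3 t ht) (by simp)
  · rintro m ⟨U, hU⟩
    obtain ⟨t, ht⟩ := hU.exists_isIsotropicFamily
    exact hmax m t ht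

variable [FiniteDimensional K W]

theorem IsWittDecomposition.card_le {Q : QuadraticForm K W} {m k : ℕ} {U : Submodule K W}
    (h : IsWittDecomposition Q m U) {t : Fin k → W} (ht : IsIsotropicFamily Q t) : k ≤ m := by
  obtain ⟨f⟩ := h.2
  exact (ht.isometryEquiv f).card_le_of_anisotropic h.1

/-- Over a finite field, quadratic forms in at least three variables are isotropic. -/
theorem finrank_le_two_of_anisotropic [Finite K] {Q : QuadraticForm K W} (hQ : Q.Anisotropic) :
    Module.finrank K W ≤ 2 := by
  classical
  by_contra! hlt
  have := Fintype.ofFinite K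
  let b := Module.finBasis K W
  let B : Fin (Module.finrank K W) → Fin (Module.finrank K W) → K := fun i j =>
    Q.toBilin b (b i) (b j)
  let f : MvPolynomial (Fin (Module.finrank K W)) K :=
    ∑ i, ∑ j, MvPolynomial.C (B i j) * MvPolynomial.X i * MvPolynomial.X j
  have hdeg : f.totalDegree ≤ 2 := by
    refine MvPolynomial.totalDegree_finsetSum_le fun i _ =>
      MvPolynomial.totalDegree_finsetSum_le fun j _ => ?_
    refine (MvPolynomial.totalDegree_mul _ _).trans ?_
    refine (add_le_add (MvPolynomial.totalDegree_mul _ _) le_rfl).trans ?_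
    simp
  have heval : ∀ x, MvPolynomial.eval x f = Q (∑ i, x i • b i) := fun x => by
    conv_rhs => rw [← QuadraticMap.toQuadraticMap_toBilin Q b]
    simp only [f, B, LinearMap.BilinMap.toQuadraticMap_apply, map_sum, LinearMap.sum_apply,
      map_smul, LinearMap.smul_apply, smul_eq_mul, map_mul, MvPolynomial.eval_C,
      MvPolynomial.eval_X]
    rw [Finset.sum_comm]
    refine Finset.sum_congr rfl fun i _ => ?_
    rw [Finset.mul_sum]
    refine Finset.sum_congr rfl fun j _ => ?_
    ring
  -- Chevalley–Warning: the characteristic divides the number of zeros, but anisotropy leaves only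
  -- the origin.
  have hdvd := char_dvd_card_solutions (ringChar K) (f := f) (by simpa using hdeg.trans_lt hlt)
  have huniq : ∀ x : { x // MvPolynomial.eval x f = 0 }, x.1 = 0 := fun x => by
    have h0 := hQ _ ((heval x.1).symm.trans x.2)
    exact funext (Fintype.linearIndependent_iff.1 b.linearIndependent x.1 h0)
  have hcard : Fintype.card { x // MvPolynomial.eval x f = 0 } = 1 :=
    Fintype.card_eq_one_iff.2 ⟨⟨0, by rw [heval]; simp⟩, fun x => Subtype.ext (huniq x)⟩
  rw [hcard, Nat.dvd_one] at hdvd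
  exact CharP.ringChar_ne_one hdvd

theorem IsWittDecomposition.finrank_le_of_finite [Finite K] {Q : QuadraticForm K W} {m : ℕ}
    {U : Submodule K W} (h : IsWittDecomposition Q m U) : Module.finrank K W ≤ 2 * m + 2 := by
  have hU := finrank_le_two_of_anisotropic h.1
  obtain ⟨f⟩ := h.2
  rw [f.toLinearEquiv.finrank_eq]
  simp only [Module.finrank_prod, Subspace.dual_finrank_eq, Module.finrank_fin_fun]
  omega

end Witt

/-- A right inverse turns independence into polynomial identities, which survive ring homomorphisms
and specialization. -/
theorem linearIndependent_iff_exists_mul_eq_one {K : Type*} [Field K] {k d : ℕ}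
    {t : Fin k → Fin d → K} :
    LinearIndependent K t ↔ ∃ S : Matrix (Fin d) (Fin k) K, Matrix.of t * S = 1 := by
  constructor
  · intro h
    have hinj : Function.Injective (Matrix.of t).vecMulLinear :=
      Matrix.vecMul_injective_iff.2 h
    obtain ⟨g, hg⟩ := LinearMap.exists_leftInverse_of_injective _ (LinearMap.ker_eq_bot.2 hinj)
    refine ⟨(LinearMap.toMatrix' g).transpose, ?_⟩
    apply Matrix.transpose_injective
    rw [Matrix.transpose_mul, Matrix.transpose_transpose, Matrix.transpose_one,
      ← LinearMap.toMatrix'_id, ← hg, LinearMap.toMatrix'_comp]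
    congr 1
    ext i j
    simp [LinearMap.toMatrix'_apply]
  · rintro ⟨S, hS⟩
    have hinj : Function.Injective (Matrix.of t).vecMul :=
      Function.LeftInverse.injective (g := fun y => Matrix.vecMul y S) fun x => by
        change Matrix.vecMul (Matrix.vecMul x _) S = x
        rw [Matrix.vecMul_vecMul, hS, Matrix.vecMul_one]
    exact Matrix.vecMul_injective_iff.1 hinj

theorem map_linearIndependent {K K' : Type*} [Field K] [Field K'] (g : K →+* K') {k d : ℕ}
    {t : Fin k → Fin d → K} (h : LinearIndependent K t) :
    LinearIndependent K' fun i j => g (t i j) := by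
  obtain ⟨S, hS⟩ := linearIndependent_iff_exists_mul_eq_one.1 h
  refine linearIndependent_iff_exists_mul_eq_one.2 ⟨S.map g, ?_⟩
  have := congrArg (fun M => M.map g) hS
  rwa [Matrix.map_mul, Matrix.map_one g (map_zero g) (map_one g)] at this

/-! ### Plücker coordinates of planes -/

section Plucker

variable {A A' : Type*} [CommRing A] [CommRing A'] {d : ℕ}

/-- The Plücker coordinates of a pair of coordinate vectors. -/
def planePlucker (x : Fin 2 → Fin d → A) (J : Fin 2 ↪o Fin d) : A :=
  x 0 (J 0) * x 1 (J 1) - x 0 (J 1) * x 1 (J 0)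

theorem planePlucker_map {G : Type*} [FunLike G A A'] [RingHomClass G A A'] (g : G)
    (x : Fin 2 → Fin d → A) (J : Fin 2 ↪o Fin d) :
    planePlucker (fun i j => g (x i j)) J = g (planePlucker x J) := by
  simp [planePlucker]

end Plucker

/-! ### The form in coordinates and its base change -/

section Coordinates

variable {F : Type u} [Field F] {V : Type v} [AddCommGroup V] [Module F V] [FiniteDimensional F V]

/-- The Gram matrix of `φ` in the fixed basis. -/
def gram (φ : QuadraticForm F V) :
    Matrix (Fin (Module.finrank F V)) (Fin (Module.finrank F V)) F :=
  Matrix.of fun i j => φ.toBilin (Module.finBasis F V) (Module.finBasis F V i)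
    (Module.finBasis F V j)

/-- The form `φ` in coordinates, over an arbitrary commutative `F`-algebra. -/
def coordForm (φ : QuadraticForm F V) (A : Type*) [CommRing A] [Algebra F A] :
    QuadraticForm A (Fin (Module.finrank F V) → A) :=
  LinearMap.BilinMap.toQuadraticMap (Matrix.toBilin' ((gram φ).map (algebraMap F A)))

section Algebra

variable (φ : QuadraticForm F V) {A A' : Type*} [CommRing A] [Algebra F A] [CommRing A']
  [Algebra F A']

theorem coordForm_apply (x : Fin (Module.finrank F V) → A) :
    coordForm φ A x = ∑ i, ∑ j, x i * algebraMap F A (gram φ i j) * x j := by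
  rw [coordForm, LinearMap.BilinMap.toQuadraticMap_apply, Matrix.toBilin'_apply]
  rfl

theorem polar_coordForm_apply (x y : Fin (Module.finrank F V) → A) :
    polar (coordForm φ A) x y = (∑ i, ∑ j, x i * algebraMap F A (gram φ i j) * y j) +
      ∑ i, ∑ j, y i * algebraMap F A (gram φ i j) * x j := by
  rw [coordForm, LinearMap.BilinMap.polar_toQuadraticMap, Matrix.toBilin'_apply,
    Matrix.toBilin'_apply]
  rfl

theorem coordForm_map (g : A →ₐ[F] A') (x : Fin (Module.finrank F V) → A) :
    coordForm φ A' (fun j => g (x j)) = g (coordForm φ A x) := by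
  simp [coordForm_apply]

theorem polar_coordForm_map (g : A →ₐ[F] A') (x y : Fin (Module.finrank F V) → A) :
    polar (coordForm φ A') (fun j => g (x j)) (fun j => g (y j)) =
      g (polar (coordForm φ A) x y) := by
  simp [polar_coordForm_apply]

theorem scaledReflection_coordForm_map (g : A →ₐ[F] A') (v x : Fin (Module.finrank F V) → A) :
    scaledReflection (coordForm φ A') (fun j => g (v j)) (fun j => g (x j)) =
      fun j => g (scaledReflection (coordForm φ A) v x j) := by
  ext j
  simp [scaledReflection_apply, coordForm_map, polar_coordForm_map]

theorem reflectionProduct_coordForm_map (g : A →ₐ[F] A')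
    (v : Fin 4 → Fin (Module.finrank F V) → A) (x : Fin (Module.finrank F V) → A) :
    reflectionProduct (coordForm φ A') (fun k j => g (v k j)) (fun j => g (x j)) =
      fun j => g (reflectionProduct (coordForm φ A) v x j) := by
  simp only [reflectionProduct, LinearMap.comp_apply, scaledReflection_coordForm_map]

end Algebra

section Field

variable {E E' : Type*} [Field E] [Algebra F E] [Field E'] [Algebra F E']

theorem IsIsotropicFamily.map_coordForm {φ : QuadraticForm F V} {k : ℕ}
    {w : Fin k → Fin (Module.finrank F V) → E} (hw : IsIsotropicFamily (coordForm φ E) w)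
    (g : E →ₐ[F] E') : IsIsotropicFamily (coordForm φ E') fun i j => g (w i j) :=
  ⟨map_linearIndependent g.toRingHom hw.linearIndependent,
    fun i => by rw [coordForm_map, hw.map_eq_zero, map_zero],
    fun i j => by rw [polar_coordForm_map, hw.polar_eq_zero, map_zero]⟩

theorem toQuadraticMap_sum {W ι : Type*} [AddCommGroup W] [Module E W] [Fintype ι]
    (B : LinearMap.BilinForm E W) (b : ι → W) (x : ι → E) :
    LinearMap.BilinMap.toQuadraticMap B (∑ i, x i • b i) =
      ∑ i, ∑ j, x i * B (b i) (b j) * x j := by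
  simp only [LinearMap.BilinMap.toQuadraticMap_apply, map_sum, LinearMap.sum_apply,
    map_smul, LinearMap.smul_apply, smul_eq_mul]
  simp only [Finset.mul_sum]
  rw [Finset.sum_comm]
  refine Finset.sum_congr rfl fun i _ => Finset.sum_congr rfl fun j _ => ?_
  ring

/-- Coordinates identify `φ_E` with `coordForm φ E`. -/
def coordIsometry (φ : QuadraticForm F V) (E : Type*) [Field E] [Algebra F E] :
    (extend φ E).IsometryEquiv (coordForm φ E) :=
  QuadraticMap.IsometryEquiv.symm
    { toLinearEquiv := ((Module.finBasis F V).baseChange E).equivFun.symm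
      map_app' := fun x => by
        change extend φ E (((Module.finBasis F V).baseChange E).equivFun.symm x) = _
        rw [coordForm_apply, Module.Basis.equivFun_symm_apply, extend, toQuadraticMap_sum]
        refine Finset.sum_congr rfl fun i _ => Finset.sum_congr rfl fun j _ => ?_
        rw [Module.Basis.baseChange_apply, Module.Basis.baseChange_apply,
          LinearMap.BilinForm.baseChange_tmul, Algebra.smul_def, mul_one, mul_one]
        rfl }

theorem coordIsometry_apply (φ : QuadraticForm F V) (x : E ⊗[F] V)
    (j : Fin (Module.finrank F V)) :
    coordIsometry φ E x j = ((Module.finBasis F V).baseChange E).repr x j :=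
  rfl

/-- The form itself in coordinates. -/
def selfCoordIsometry (φ : QuadraticForm F V) : φ.IsometryEquiv (coordForm φ F) :=
  QuadraticMap.IsometryEquiv.symm
    { toLinearEquiv := (Module.finBasis F V).equivFun.symm
      map_app' := fun x => by
        change φ ((Module.finBasis F V).equivFun.symm x) = _
        rw [coordForm_apply, Module.Basis.equivFun_symm_apply]
        conv_lhs => rw [← QuadraticMap.toQuadraticMap_toBilin φ (Module.finBasis F V)]
        rw [toQuadraticMap_sum]
        rfl }

theorem polar_isometryEquiv {K W W' : Type*} [Field K] [AddCommGroup W] [Module K W]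
    [AddCommGroup W'] [Module K W'] {Q : QuadraticForm K W} {Q' : QuadraticForm K W'}
    (f : Q.IsometryEquiv Q') (x y : W) : polar Q' (f x) (f y) = polar Q x y := by
  have h : f x + f y = f (x + y) := (map_add f.toLinearEquiv x y).symm
  simp only [polar, h, f.map_app]

/-- The radical of a nondegenerate form stays zero under field extensions. -/
theorem radical_coordForm {φ : QuadraticForm F V} (hφ : IsNondegenerate φ) :
    (coordForm φ E).radical = ⊥ := by
  -- `r`, possibly zero, spans the radical of the polar form over `F`.
  obtain ⟨r, hr⟩ : ∃ r : Fin (Module.finrank F V) → F, (∀ y, polar (coordForm φ F) r y = 0) ∧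
      ∀ x, (∀ y, polar (coordForm φ F) x y = 0) → ∃ c : F, c • r = x := by
    obtain ⟨⟨r, hr⟩, h⟩ := finrank_le_one_iff.1 hφ.2
    let f := selfCoordIsometry φ
    refine ⟨f r, fun y => ?_, fun x hx => ?_⟩
    · obtain ⟨y, rfl⟩ := f.toLinearEquiv.surjective y
      exact (polar_isometryEquiv f r y).trans (LinearMap.congr_fun hr y)
    · obtain ⟨x, rfl⟩ := f.toLinearEquiv.surjective x
      obtain ⟨c, hc⟩ := h ⟨x, LinearMap.ext fun y =>
        (polar_isometryEquiv f x y).symm.trans (hx _)⟩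
      exact ⟨c, (map_smul f.toLinearEquiv c r).symm.trans
        (congrArg f.toLinearEquiv (congrArg Subtype.val hc))⟩
  have hF : (coordForm φ F).radical = ⊥ := by
    rw [← (selfCoordIsometry φ).map_radical, hφ.1, Submodule.map_bot]
  rw [eq_bot_iff]
  intro x hx
  obtain ⟨hx0, hx1⟩ := mem_radical_iff'.1 hx
  have hpol : ∀ y, polar (coordForm φ E) x y = 0 := fun y => by rw [polar, hx1, hx0]; simp
  -- An `F`-linear functional applied to the coordinates of `x` gives a vector in the polar radical
  -- over `F`. As functionals separate points of `E`, this makes `x` an `E`-multiple of `r`.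
  have hdual : ∀ l : Module.Dual F E, ∃ c : F, c • r = fun j => l (x j) := fun l => by
    refine hr.2 _ fun y => ?_
    have h := congrArg l (hpol fun j => algebraMap F E (y j))
    rw [polar_coordForm_apply, map_zero] at h
    rw [polar_coordForm_apply, ← h]
    have h1 : ∀ i j, x i * algebraMap F E (gram φ i j) * algebraMap F E (y j) =
        (gram φ i j * y j) • x i := fun i j => by rw [Algebra.smul_def, map_mul]; ring
    have h2 : ∀ i j, algebraMap F E (y i) * algebraMap F E (gram φ i j) * x j =
        (y i * gram φ i j) • x j := fun i j => by rw [Algebra.smul_def, map_mul]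
    simp only [h1, h2, map_add, map_sum, map_smul, smul_eq_mul, Algebra.algebraMap_self,
      RingHom.id_apply]
    congr 1
    refine Finset.sum_congr rfl fun i _ => Finset.sum_congr rfl fun j _ => ?_
    ring
  have hsep : ∀ z : E, (∀ l : Module.Dual F E, l z = 0) → z = 0 := fun z =>
    (Module.forall_dual_apply_eq_zero_iff F z).1
  by_cases hr0 : r = 0
  · ext j
    refine hsep _ fun l => ?_
    obtain ⟨c, hc⟩ := hdual l
    rw [← congrFun hc j, hr0]
    simp
  · obtain ⟨a, ha⟩ := Function.ne_iff.1 hr0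
    have hprop : ∀ j, r a • x j = r j • x a := fun j => by
      rw [← sub_eq_zero]
      refine hsep _ fun l => ?_
      obtain ⟨c, hc⟩ := hdual l
      have hj := congrFun hc j
      have ha := congrFun hc a
      simp only [Pi.smul_apply, smul_eq_mul] at hj ha
      rw [map_sub, map_smul, map_smul, ← hj, ← ha, smul_eq_mul, smul_eq_mul]
      ring
    have ha' : algebraMap F E (r a) ≠ 0 := by simpa using ha
    have hx' : x = (x a / algebraMap F E (r a)) • fun j => algebraMap F E (r j) := by
      ext j
      have := hprop j
      rw [Algebra.smul_def, Algebra.smul_def] at this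
      rw [Pi.smul_apply, smul_eq_mul]
      field_simp
      linear_combination this
    -- Nondegeneracy over `F` gives `Q r ≠ 0`, so an isotropic multiple of `r` over `E` must vanish.
    have hQr : coordForm φ F r ≠ 0 := fun h => hr0 (eq_zero_of_radical_eq_bot hF h hr.1)
    rw [hx', QuadraticMap.map_smul] at hx0
    have hm := coordForm_map φ (Algebra.ofId F E) r
    simp only [Algebra.ofId_apply] at hm
    rw [hm, smul_eq_mul, mul_eq_zero, or_iff_left (by simpa using hQr), mul_self_eq_zero] at hx0
    rw [hx', hx0, zero_smul]
    exact zero_mem _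

end Field

theorem mem_isotropicIdeal_iff {φ : QuadraticForm F V}
    {f : MvPolynomial (PluckerIndex F V 2) F} :
    f ∈ isotropicIdeal φ 2 ↔ ∀ (E : Type u) [Field E] [Algebra F E]
      (x : Fin 2 → Fin (Module.finrank F V) → E), IsIsotropicFamily (coordForm φ E) x →
        MvPolynomial.aeval (planePlucker x) f = 0 := by
  have hpl : ∀ (E : Type u) [Field E] [Algebra F E] (w : Fin 2 → E ⊗[F] V),
      pluckerCoord F w = planePlucker fun i => coordIsometry φ E (w i) := by
    intro E _ _ w
    ext J
    simp only [pluckerCoord, planePlucker, Matrix.det_fin_two, Matrix.of_apply,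
      coordIsometry_apply]
  constructor
  · intro h E _ _ x hx
    have hw := hx.isometryEquiv (coordIsometry φ E).symm
    have := h E _ hw.linearIndependent fun z hz => hw.map_eq_zero_of_mem hz
    rw [hpl] at this
    simpa using this
  · intro h E _ _ w hw hiso
    rw [hpl]
    exact h E _ ((IsIsotropicFamily.of_forall_mem_span hw hiso).isometryEquiv (coordIsometry φ E))

end Coordinates

/-! ### The generic plane and density of rational points -/

section GenericPlane

variable {F : Type u} [Field F] {V : Type v} [AddCommGroup V] [Module F V] [FiniteDimensional F V]

/-- A residue field of `E ⊗ L` contains both fields; its algebraic closure lets an arbitrary plane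
over `E` be compared with the fixed one over `L`. -/
theorem exists_common_isAlgClosed (F E L : Type u) [Field F] [Field E] [Field L] [Algebra F E]
    [Algebra F L] : ∃ (Ω : Type u) (_ : Field Ω) (_ : Algebra F Ω) (_ : IsAlgClosed Ω)
      (_ : E →ₐ[F] Ω) (_ : L →ₐ[F] Ω), True := by
  obtain ⟨m, hm⟩ := Ideal.exists_maximal (E ⊗[F] L)
  let k := (E ⊗[F] L) ⧸ m
  let _ : Field k := Ideal.Quotient.field m
  let g : E ⊗[F] L →ₐ[F] AlgebraicClosure k :=
    (IsScalarTower.toAlgHom F k (AlgebraicClosure k)).comp (Ideal.Quotient.mkₐ F m)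
  exact ⟨AlgebraicClosure k, inferInstance, inferInstance, inferInstance,
    g.comp Algebra.TensorProduct.includeLeft, g.comp Algebra.TensorProduct.includeRight, trivial⟩

section Specialize

variable {L : Type u} [Field L] [Algebra F L]

/-- The substitution `X (k, j) ↦ a k j`, with `g` on the coefficients. -/
def specialize {A : Type*} [CommRing A] [Algebra F A] {d : ℕ} (g : L →ₐ[F] A)
    (a : Fin 4 → Fin d → A) : MvPolynomial (Fin 4 × Fin d) L →ₐ[F] A :=
  { MvPolynomial.eval₂Hom g.toRingHom fun p => a p.1 p.2 with
    commutes' := fun r => by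
      simp [MvPolynomial.algebraMap_eq, IsScalarTower.algebraMap_apply F L (MvPolynomial _ L)] }

theorem specialize_X {A : Type*} [CommRing A] [Algebra F A] {d : ℕ} (g : L →ₐ[F] A)
    (a : Fin 4 → Fin d → A) (k : Fin 4) (j : Fin d) :
    specialize g a (MvPolynomial.X (k, j)) = a k j :=
  MvPolynomial.eval₂_X ..

theorem specialize_C {A : Type*} [CommRing A] [Algebra F A] {d : ℕ} (g : L →ₐ[F] A)
    (a : Fin 4 → Fin d → A) (c : L) : specialize g a (MvPolynomial.C c) = g c :=
  MvPolynomial.eval₂_C ..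

variable (φ : QuadraticForm F V) (e : Fin 2 → Fin (Module.finrank F V) → L)

/-- The image of the plane with basis `e` under a product of reflections in four generic
vectors. -/
def genericPlane (i : Fin 2) :
    Fin (Module.finrank F V) → MvPolynomial (Fin 4 × Fin (Module.finrank F V)) L :=
  reflectionProduct (coordForm φ _) (fun k j => MvPolynomial.X (k, j))
    fun j => MvPolynomial.C (e i j)

theorem specialize_genericPlane {A : Type*} [CommRing A] [Algebra F A] (g : L →ₐ[F] A)
    (a : Fin 4 → Fin (Module.finrank F V) → A) (i : Fin 2) :
    (fun j => specialize g a (genericPlane φ e i j)) =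
      reflectionProduct (coordForm φ A) a fun j => g (e i j) := by
  rw [genericPlane, ← reflectionProduct_coordForm_map]
  simp only [specialize_X, specialize_C]

/-- Evaluation at the Plücker coordinates of the generic plane. -/
def genericPoint : MvPolynomial (PluckerIndex F V 2) F →ₐ[F]
    MvPolynomial (Fin 4 × Fin (Module.finrank F V)) L :=
  MvPolynomial.aeval (planePlucker (genericPlane φ e))

theorem map_aeval_planePlucker {A A' : Type*} [CommRing A] [Algebra F A] [CommRing A']
    [Algebra F A'] {d : ℕ} (g : A →ₐ[F] A') (x : Fin 2 → Fin d → A)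
    (f : MvPolynomial (Fin 2 ↪o Fin d) F) :
    g (MvPolynomial.aeval (planePlucker x) f) =
      MvPolynomial.aeval (planePlucker fun i j => g (x i j)) f := by
  rw [MvPolynomial.comp_aeval_apply]
  congr 2
  ext J
  rw [planePlucker_map]

theorem specialize_genericPoint {A : Type*} [CommRing A] [Algebra F A] (g : L →ₐ[F] A)
    (a : Fin 4 → Fin (Module.finrank F V) → A) (f : MvPolynomial (PluckerIndex F V 2) F) :
    specialize g a (genericPoint φ e f) = MvPolynomial.aeval
      (planePlucker fun i => reflectionProduct (coordForm φ A) a fun j => g (e i j)) f := by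
  rw [genericPoint, map_aeval_planePlucker]
  simp only [← specialize_genericPlane]

variable {φ e}

/-- The generic value specializes to a nonzero value at an anisotropic vector over `L`. -/
theorem coordForm_generic_ne_zero (hφ : IsNondegenerate φ) (hd : 7 ≤ Module.finrank F V)
    (k : Fin 4) : coordForm φ (MvPolynomial (Fin 4 × Fin (Module.finrank F V)) L)
      (fun j => MvPolynomial.X (k, j)) ≠ 0 := by
  intro h
  obtain ⟨a, -, -, -, ha⟩ := exists_orthogonal_anisotropic (radical_coordForm (E := L) hφ)
    (by simpa using hd) 0 0 0
  apply ha
  have := congrArg (specialize (AlgHom.id F L) fun _ => a) h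
  rw [← coordForm_map, map_zero] at this
  simpa only [specialize_X] using this

/-- The generic plane is a generic point of the variety of totally isotropic planes. -/
theorem mem_isotropicIdeal_iff_genericPoint (hφ : IsNondegenerate φ)
    (hd : 7 ≤ Module.finrank F V) (he : IsIsotropicFamily (coordForm φ L) e)
    {f : MvPolynomial (PluckerIndex F V 2) F} :
    f ∈ isotropicIdeal φ 2 ↔ genericPoint φ e f = 0 := by
  rw [mem_isotropicIdeal_iff]
  constructor
  -- Over the fraction field the generic vectors are anisotropic, so the generic plane is a genuine
  -- isotropic plane, to which `h` applies.
  · intro h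
    let R := MvPolynomial (Fin 4 × Fin (Module.finrank F V)) L
    let g : R →ₐ[F] FractionRing R := IsScalarTower.toAlgHom F R (FractionRing R)
    have hg : Function.Injective g := IsFractionRing.injective R (FractionRing R)
    let c : L →ₐ[F] R := IsScalarTower.toAlgHom F L R
    have hfam := (he.map_coordForm (g.comp c)).reflectionProduct
      (x := fun k j => g (MvPolynomial.X (k, j))) fun k => by
        rw [coordForm_map]
        exact fun h0 => coordForm_generic_ne_zero hφ hd k (hg (h0.trans (map_zero g).symm))
    have h0 := h _ _ hfam
    apply hg
    rw [map_zero, genericPoint, map_aeval_planePlucker, ← h0]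
    congr 3
    ext i : 1
    exact (reflectionProduct_coordForm_map φ g _ _).symm
  -- By transitivity over `Ω`, every isotropic plane is a specialization of the generic one.
  · intro h E _ _ x hx
    obtain ⟨Ω, _, _, _, gE, gL, -⟩ := exists_common_isAlgClosed F E L
    obtain ⟨a, ha⟩ := exists_reflectionProduct_eq (radical_coordForm (E := Ω) hφ)
      (by simpa using hd) (he.map_coordForm gL) (hx.map_coordForm gE)
    have hinj : Function.Injective gE := gE.injective
    apply hinj
    rw [map_zero, map_aeval_planePlucker, ← map_zero (specialize gL a), ← h,
      specialize_genericPoint]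
    simp only [ha]

/-- The ideal is the kernel of a map into a polynomial ring over a field. -/
theorem isotropicIdeal_isPrime (hφ : IsNondegenerate φ) (hd : 7 ≤ Module.finrank F V)
    (he : IsIsotropicFamily (coordForm φ L) e) : (isotropicIdeal φ 2).IsPrime := by
  have : isotropicIdeal φ 2 = RingHom.ker (genericPoint φ e) :=
    Ideal.ext fun f => mem_isotropicIdeal_iff_genericPoint hφ hd he
  rw [this]
  exact RingHom.ker_isPrime _

theorem isotropicPrime_eq (hφ : IsNondegenerate φ) (hd : 7 ≤ Module.finrank F V)
    (he : IsIsotropicFamily (coordForm φ L) e) : isotropicPrime φ 2 = isotropicIdeal φ 2 :=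
  if_pos (isotropicIdeal_isPrime hφ hd he)

/-- Over an infinite field, the rational points of the variety of totally isotropic planes are
dense as soon as there is one. -/
theorem exists_algHom_coordRing [Infinite L] (hφ : IsNondegenerate φ)
    (hd : 7 ≤ Module.finrank F V) (he : IsIsotropicFamily (coordForm φ L) e)
    {c : CoordRing φ 2} (hc : c ≠ 0) : ∃ g : CoordRing φ 2 →ₐ[F] L, g c ≠ 0 := by
  have hmem : ∀ f, f ∈ isotropicPrime φ 2 ↔ genericPoint φ e f = 0 := fun f => by
    rw [isotropicPrime_eq hφ hd he, mem_isotropicIdeal_iff_genericPoint hφ hd he]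
  obtain ⟨f, rfl⟩ := Ideal.Quotient.mk_surjective c
  have hf : genericPoint φ e f ≠ 0 := fun h => hc (Ideal.Quotient.eq_zero_iff_mem.2 ((hmem f).2 h))
  -- A nonzero polynomial over an infinite field has a nonzero value.
  obtain ⟨a, ha⟩ : ∃ a, MvPolynomial.eval a (genericPoint φ e f) ≠ 0 := by
    by_contra! hcon
    exact hf (MvPolynomial.funext fun a => (hcon a).trans (map_zero _).symm)
  let s := specialize (AlgHom.id F L) fun k j => a (k, j)
  refine ⟨Ideal.Quotient.liftₐ _ (s.comp (genericPoint φ e)) fun p hp => ?_, ?_⟩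
  · rw [AlgHom.comp_apply, (hmem p).1 hp, map_zero]
  · exact ha

end Specialize

/-- An isotropic family over the fraction field of `C` can be specialized at all points where some
nonzero element of `C` does not vanish. -/
theorem IsIsotropicFamily.exists_specialization {φ : QuadraticForm F V} {C N : Type*} [CommRing C]
    [IsDomain C] [Field N] [Algebra F C] [Algebra F N] [Algebra C N] [IsScalarTower F C N]
    [IsFractionRing C N] {k : ℕ} {t : Fin k → Fin (Module.finrank F V) → N}
    (ht : IsIsotropicFamily (coordForm φ N) t) :
    ∃ c : C, c ≠ 0 ∧ ∀ (L : Type u) [Field L] [Algebra F L] (g : C →ₐ[F] L), g c ≠ 0 →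
      ∃ s : Fin k → Fin (Module.finrank F V) → L, IsIsotropicFamily (coordForm φ L) s := by
  obtain ⟨S, hS⟩ := linearIndependent_iff_exists_mul_eq_one.1 ht.linearIndependent
  -- `b` is a common denominator for the family and for its right inverse; it serves as `c`.
  obtain ⟨b, hb⟩ := IsLocalization.exist_integer_multiples_of_finite (nonZeroDivisors C)
    (Sum.elim (fun p : Fin k × Fin (Module.finrank F V) => t p.1 p.2)
      fun p : Fin (Module.finrank F V) × Fin k => S p.1 p.2)
  have ht' : ∀ i j, ∃ c : C, algebraMap C N c = (b : C) • t i j := fun i j => hb (Sum.inl (i, j))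
  have hS' : ∀ j i, ∃ c : C, algebraMap C N c = (b : C) • S j i := fun j i => hb (Sum.inr (j, i))
  choose t' ht' using ht'
  choose S' hS' using hS'
  let ι : C →ₐ[F] N := IsScalarTower.toAlgHom F C N
  have hι : Function.Injective ι := IsFractionRing.injective C N
  have htι : ∀ i, (fun j => ι (t' i j)) = ι b • t i := fun i => by
    ext j
    rw [Pi.smul_apply, smul_eq_mul]
    exact (ht' i j).trans (Algebra.smul_def _ _)
  have hb0 : (b : C) ≠ 0 := nonZeroDivisors.ne_zero b.2
  refine ⟨b, hb0, fun L _ _ g hg => ⟨fun i j => g (t' i j), ?_, fun i => ?_, fun i j => ?_⟩⟩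
  · refine linearIndependent_iff_exists_mul_eq_one.2
      ⟨Matrix.of fun j i => (g b)⁻¹ * (g b)⁻¹ * g (S' j i), ?_⟩
    -- The cleared matrices multiply to `b ^ 2`, which stays invertible wherever `g b ≠ 0`.
    have hC : ∀ i i', ∑ j, t' i j * S' j i' = (b : C) * b * (1 : Matrix (Fin k) (Fin k) C) i i' := by
      intro i i'
      apply hι
      have h1 : ∑ j, t i j * S j i' = (1 : Matrix (Fin k) (Fin k) N) i i' := by
        rw [← hS]; rfl
      have h2 : ι ((1 : Matrix (Fin k) (Fin k) C) i i') = (1 : Matrix (Fin k) (Fin k) N) i i' := by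
        simp [Matrix.one_apply, apply_ite ι]
      rw [map_sum, map_mul, map_mul, h2, ← h1, Finset.mul_sum]
      refine Finset.sum_congr rfl fun j _ => ?_
      have h3 : ι (t' i j) = ι b * t i j := (ht' i j).trans (Algebra.smul_def _ _)
      have h4 : ι (S' j i') = ι b * S j i' := (hS' j i').trans (Algebra.smul_def _ _)
      rw [map_mul, h3, h4]
      ring
    ext i i'
    have h1 := congrArg g (hC i i')
    have h2 : g ((1 : Matrix (Fin k) (Fin k) C) i i') = (1 : Matrix (Fin k) (Fin k) L) i i' := by
      simp [Matrix.one_apply, apply_ite g]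
    rw [map_sum, map_mul, map_mul, h2] at h1
    rw [Matrix.mul_apply]
    calc _ = (g b)⁻¹ * (g b)⁻¹ * ∑ j, g (t' i j * S' j i') := by
          rw [Finset.mul_sum]
          refine Finset.sum_congr rfl fun j _ => ?_
          rw [map_mul, Matrix.of_apply, Matrix.of_apply]
          ring
      _ = _ := by rw [h1]; field_simp
  · rw [coordForm_map]
    have h0 : ι (coordForm φ C (t' i)) = 0 := by
      rw [← coordForm_map, htι, QuadraticMap.map_smul, ht.map_eq_zero, smul_zero]
    rw [hι (h0.trans (map_zero ι).symm), map_zero]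
  · rw [polar_coordForm_map]
    have h0 : ι (polar (coordForm φ C) (t' i) (t' j)) = 0 := by
      rw [← polar_coordForm_map, htι, htι, polar_smul_left, polar_smul_right, ht.polar_eq_zero,
        smul_zero, smul_zero]
    rw [hι (h0.trans (map_zero ι).symm), map_zero]

/-! ### The tautological plane over the function field -/

section Tautological

/-- The Plücker coordinates as an alternating matrix. -/
def signedPlucker (F : Type u) [Field F] {d : ℕ} (i j : Fin d) :
    MvPolynomial (Fin 2 ↪o Fin d) F :=
  if h : i < j then MvPolynomial.X (OrderEmbedding.ofStrictMono ![i, j] (by simpa [StrictMono]))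
  else if h : j < i then
    -MvPolynomial.X (OrderEmbedding.ofStrictMono ![j, i] (by simpa [StrictMono]))
  else 0

theorem aeval_signedPlucker {A : Type*} [CommRing A] [Algebra F A] {d : ℕ}
    (x : Fin 2 → Fin d → A) (i j : Fin d) :
    MvPolynomial.aeval (planePlucker x) (signedPlucker F i j) =
      x 0 i * x 1 j - x 0 j * x 1 i := by
  unfold signedPlucker
  split_ifs with h1 h2
  · simp [planePlucker]
  · simp [planePlucker]
  · obtain rfl : i = j := le_antisymm (not_lt.1 h2) (not_lt.1 h1)
    simp

theorem isHomogeneous_signedPlucker {d : ℕ} (i j : Fin d) :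
    (signedPlucker F i j).IsHomogeneous 1 := by
  unfold signedPlucker
  split_ifs
  · exact MvPolynomial.isHomogeneous_X ..
  · exact (MvPolynomial.isHomogeneous_X ..).neg
  · exact MvPolynomial.isHomogeneous_zero ..

theorem signedPlucker_self {d : ℕ} (i : Fin d) : signedPlucker F i i = 0 := by
  simp [signedPlucker]

/-- The two vectors of a plane in the chart where its `(a, b)` Plücker coordinate is nonzero, up
to that coordinate. -/
def chartBasis (F : Type u) [Field F] {d : ℕ} (a b : Fin d) (i : Fin 2) (j : Fin d) :
    MvPolynomial (Fin 2 ↪o Fin d) F :=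
  if i = 0 then signedPlucker F j b else signedPlucker F a j

/-- These vectors are contractions of `x 0 ∧ x 1` with a coordinate functional, hence lie in the
plane of `x`. -/
theorem aeval_chartBasis {A : Type*} [CommRing A] [Algebra F A] {d : ℕ}
    (x : Fin 2 → Fin d → A) (a b : Fin d) (i : Fin 2) :
    (fun j => MvPolynomial.aeval (planePlucker x) (chartBasis F a b i j)) =
      if i = 0 then x 1 b • x 0 - x 0 b • x 1 else x 0 a • x 1 - x 1 a • x 0 := by
  ext j
  unfold chartBasis
  split_ifs <;> rw [aeval_signedPlucker] <;> simp <;> ring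

theorem aeval_chartBasis_mem {E : Type*} [Field E] [Algebra F E] {d : ℕ}
    (x : Fin 2 → Fin d → E) (a b : Fin d) (i : Fin 2) :
    (fun j => MvPolynomial.aeval (planePlucker x) (chartBasis F a b i j)) ∈
      Submodule.span E (Set.range x) := by
  have hm : ∀ i, x i ∈ Submodule.span E (Set.range x) := fun i =>
    Submodule.subset_span (Set.mem_range_self i)
  rw [aeval_chartBasis]
  split_ifs
  · exact sub_mem (Submodule.smul_mem _ _ (hm 0)) (Submodule.smul_mem _ _ (hm 1))
  · exact sub_mem (Submodule.smul_mem _ _ (hm 1)) (Submodule.smul_mem _ _ (hm 0))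

theorem coordForm_chartBasis_mem (φ : QuadraticForm F V) (a b : Fin (Module.finrank F V))
    (i : Fin 2) : coordForm φ _ (chartBasis F a b i) ∈ isotropicIdeal φ 2 := by
  refine mem_isotropicIdeal_iff.2 fun E _ _ x hx => ?_
  rw [← coordForm_map]
  exact hx.map_eq_zero_of_mem (aeval_chartBasis_mem x a b i)

theorem polar_chartBasis_mem (φ : QuadraticForm F V) (a b : Fin (Module.finrank F V))
    (i i' : Fin 2) : polar (coordForm φ _) (chartBasis F a b i) (chartBasis F a b i') ∈
      isotropicIdeal φ 2 := by
  refine mem_isotropicIdeal_iff.2 fun E _ _ x hx => ?_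
  rw [← polar_coordForm_map]
  exact hx.polar_eq_zero_of_mem (aeval_chartBasis_mem x a b i) (aeval_chartBasis_mem x a b i')

/-- If all the minors vanished at `e`, then `e 0 a • e 1 = e 1 a • e 0` with `e 0 a ≠ 0` would
contradict independence. -/
theorem exists_signedPlucker_notMem {φ : QuadraticForm F V} {L : Type u} [Field L] [Algebra F L]
    {e : Fin 2 → Fin (Module.finrank F V) → L} (he : IsIsotropicFamily (coordForm φ L) e) :
    ∃ a b, signedPlucker F a b ∉ isotropicIdeal φ 2 := by
  by_contra! hcon
  have h : ∀ a b, e 0 a * e 1 b - e 0 b * e 1 a = 0 := fun a b => by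
    rw [← aeval_signedPlucker (F := F)]
    exact mem_isotropicIdeal_iff.1 (hcon a b) L e he
  obtain ⟨a, ha⟩ := Function.ne_iff.1 (he.linearIndependent.ne_zero 0)
  have hli := Fintype.linearIndependent_iff.1 he.linearIndependent ![-e 1 a, e 0 a] (by
    ext b
    simp only [Fin.sum_univ_two, Matrix.cons_val_zero, Matrix.cons_val_one, Pi.add_apply,
      Pi.smul_apply, smul_eq_mul, Pi.zero_apply]
    linear_combination h a b) 1
  exact ha (by simpa using hli)

/-- The tautological totally isotropic plane over the function field of `X_2`. -/
theorem exists_isIsotropicFamily_functionField {φ : QuadraticForm F V}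
    (hp : isotropicPrime φ 2 = isotropicIdeal φ 2) {a b : Fin (Module.finrank F V)}
    (hab : signedPlucker F a b ∉ isotropicIdeal φ 2) :
    ∃ w : Fin 2 → Fin (Module.finrank F V) → functionField φ 2,
      IsIsotropicFamily (coordForm φ (functionField φ 2)) w := by
  let N := FractionRing (CoordRing φ 2)
  let q : MvPolynomial (PluckerIndex F V 2) F →ₐ[F] CoordRing φ 2 :=
    Ideal.Quotient.mkₐ F (isotropicPrime φ 2)
  let g : MvPolynomial (PluckerIndex F V 2) F →ₐ[F] N :=
    (IsScalarTower.toAlgHom F (CoordRing φ 2) N).comp q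
  have hg : ∀ f, g f = 0 ↔ f ∈ isotropicIdeal φ 2 := fun f => by
    rw [← hp, ← Ideal.Quotient.eq_zero_iff_mem]
    exact map_eq_zero_iff _ (IsFractionRing.injective (CoordRing φ 2) N)
  -- Quotients of linear forms in the Plücker coordinates have degree zero.
  have hmem : ∀ i j, g (chartBasis F a b i j) / g (signedPlucker F a b) ∈ functionField φ 2 :=
    fun i j => IntermediateField.subset_adjoin _ _
      ⟨1, _, _, by unfold chartBasis; split_ifs <;> exact isHomogeneous_signedPlucker _ _,
        isHomogeneous_signedPlucker a b, rfl⟩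
  let w : Fin 2 → Fin (Module.finrank F V) → functionField φ 2 := fun i j => ⟨_, hmem i j⟩
  let ι : functionField φ 2 →ₐ[F] N := (functionField φ 2).val
  have hι : Function.Injective ι := ι.injective
  have hw : ∀ i, (fun j => ι (w i j)) =
      (g (signedPlucker F a b))⁻¹ • fun j => g (chartBasis F a b i j) := fun i => by
    ext j
    exact div_eq_inv_mul _ _
  have hab' : g (signedPlucker F a b) ≠ 0 := fun h => hab ((hg _).1 h)
  refine ⟨w, ?_, fun i => hι ?_, fun i j => hι ?_⟩
  -- Columns `a` and `b` of the normalized chart basis form the identity matrix.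
  · refine linearIndependent_iff_exists_mul_eq_one.2
      ⟨Matrix.of fun j i => if j = (if i = 0 then a else b) then 1 else 0, ?_⟩
    refine Matrix.ext fun i i' => ?_
    rw [Matrix.mul_apply]
    simp only [Matrix.of_apply, mul_ite, mul_one, mul_zero, Finset.sum_ite_eq', Finset.mem_univ,
      if_true]
    apply hι
    change g _ / g _ = _
    fin_cases i <;> fin_cases i' <;>
      simp [chartBasis, signedPlucker_self, div_self hab', ι]
  · rw [map_zero, ← coordForm_map, hw, QuadraticMap.map_smul, coordForm_map,
      (hg _).2 (coordForm_chartBasis_mem φ a b i), smul_zero]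
  · rw [map_zero, ← polar_coordForm_map, hw, hw, polar_smul_left, polar_smul_right,
      polar_coordForm_map, (hg _).2 (polar_chartBasis_mem φ a b i j), smul_zero, smul_zero]

end Tautological

/-! ### Comparison of Witt indices -/

/-- If the Witt index of `φ` is two over some field extension, then it is two over the function
field of the variety of totally isotropic planes. -/
theorem wittIndex_extend_functionField {φ : QuadraticForm F V} (hφ : IsNondegenerate φ)
    (hd : 7 ≤ Module.finrank F V) (L : Type u) [Field L] [Algebra F L]
    (hL : wittIndex (extend φ L) = 2) : wittIndex (extend φ (functionField φ 2)) = 2 := by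
  obtain ⟨U, hU⟩ : ∃ U : Submodule L (L ⊗[F] V), IsWittDecomposition (extend φ L) 2 U := by
    -- `sSup` on `ℕ` is 0 for empty or unbounded sets, so a nonzero value is attained.
    have hne : wittIndex (extend φ L) ≠ 0 := by rw [hL]; simp
    have hmem := Nat.sSup_mem (s := {m | ∃ U, IsWittDecomposition (extend φ L) m U})
      (Set.nonempty_iff_ne_empty.2 fun h => hne (by rw [wittIndex, h]; simp))
      (by
        by_contra hb
        exact hne (Nat.sSup_of_not_bddAbove hb))
    change ∃ U, IsWittDecomposition (extend φ L) (wittIndex (extend φ L)) U at hmem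
    rwa [hL] at hmem
  have : Infinite L := by
    by_contra hfin
    rw [not_infinite_iff_finite] at hfin
    have h := hU.finrank_le_of_finite
    rw [Module.finrank_baseChange] at h
    omega
  obtain ⟨e', he'⟩ := hU.exists_isIsotropicFamily
  have he := he'.isometryEquiv (coordIsometry φ L)
  have hp := isotropicPrime_eq hφ hd he
  refine wittIndex_eq_two ?_ ?_ fun k t ht => ?_
  · rw [← (coordIsometry φ _).symm.map_radical, radical_coordForm hφ, Submodule.map_bot]
  · obtain ⟨a, b, hab⟩ := exists_signedPlucker_notMem he
    obtain ⟨w, hw⟩ := exists_isIsotropicFamily_functionField hp hab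
    exact ⟨_, hw.isometryEquiv (coordIsometry φ _).symm⟩
  -- The function field is only the degree-zero part, so the family is first moved to the full
  -- fraction field of the coordinate ring.
  · obtain ⟨c, hc, h⟩ := ((ht.isometryEquiv (coordIsometry φ _)).map_coordForm
      (functionField φ 2).val).exists_specialization (C := CoordRing φ 2)
    obtain ⟨g, hg⟩ := exists_algHom_coordRing hφ hd he hc
    obtain ⟨s, hs⟩ := h L g hg
    exact hU.card_le (hs.isometryEquiv (coordIsometry φ L).symm)

end GenericPlane

end QuadForm

end

theorem mainTheorem4 {F : Type*} [Field F] {V : Type*} [AddCommGroup V] [Module F V]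
    [FiniteDimensional F V] (n : ℕ) (hn : 3 ≤ n) (hV : Module.finrank F V = 2 * n + 1)
    (φ : QuadraticForm F V) (hφ : QuadForm.IsNondegenerate φ)
    (hj : QuadForm.absoluteWittIndex φ 2 = 2) :
    QuadForm.wittIndex (QuadForm.extend φ (QuadForm.functionField φ 2)) = 2 :=
  QuadForm.wittIndex_extend_functionField hφ (by omega) _ hj
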